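/- Let $\mathcal Z$ be a nonempty compact topological space, and let $\mathcal F$ be a nonempty compact convex subset of a real topological vector space $E$. Let $\ell:\mathcal Z\times\mathcal F\to\mathbb R$ be continuous (hence bounded), and convex in its second argument. For $T\ge 1$, the minimax regret of the $T$-round online convex optimization game is $$\mathrm{Reg}_T=\inf_{f_1\in\mathcal F}\sup_{z_1\in\mathcal Z}\cdots\inf_{f_T\in\mathcal F}\sup_{z_T\in\mathcal Z}\left(\sum_{t=1}^T\ell(z_t,f_t)-\inf_{f\in\mathcal F}\sum_{t=1}^T\ell(z_t,f)\right).$$ Let $\|\cdot\|$ be a norm on $E$ (which need not induce the topology of $E$), let $\sigma>0$ and $L\in\mathbb R$, and suppose that for all $z\in\mathcal Z$ and $f,g\in\mathcal F$ $$\ell\left(z,\tfrac{f+g}{2}\right)\le\frac{\ell(z,f)+\ell(z,g)}{2}-\frac{\sigma}{8}\|f-g\|^2\quad\text{($\sigma$-strong convexity)}$$ and $$|\ell(z,f)-\ell(z,g)|\le L\|f-g\|\quad\text{($L$-Lipschitz)}.$$ Then for every integer $T\ge 2$, $$\mathrm{Reg}_T\le\frac{8L^2}{\sigma}\log T,$$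 where $\log$ is the natural logarithm. -/

import Mathlib

namespace OCO

/-- The regret of the player after the rounds recorded in the history `h`, a list of pairs
`(z_t, f_t)` of moves: `∑ ℓ(z_t, f_t) - inf_{g ∈ F} ∑ ℓ(z_t, g)`.
Infima and suprema are taken in the complete lattice `EReal`, so that they are the genuine ones. -/
noncomputable def regret {Z E : Type*} (ℓ : Z → E → ℝ) (F : Set E) (h : List (Z × F)) : EReal :=
  (((h.map fun r => ℓ r.1 r.2).sum : ℝ) : EReal)
    - ⨅ g : F, (((h.map fun r => ℓ r.1 g).sum : ℝ) : EReal)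

/-- The value of the game when `n` rounds remain to be played after the history `h`: in each round
the player chooses `f ∈ F` to minimize, then the adversary, who has seen `f`, chooses `z` to
maximize; the final payoff is the regret. -/
noncomputable def gameValue {Z E : Type*} (ℓ : Z → E → ℝ) (F : Set E) :
    ℕ → List (Z × F) → EReal
  | 0, h => regret ℓ F h
  | n + 1, h => ⨅ f : F, ⨆ z : Z, gameValue ℓ F n (h ++ [(z, f)])

/-- The minimax regret of the `T`-round game,
`inf_{f₁} sup_{z₁} ⋯ inf_{f_T} sup_{z_T} (∑ ℓ(z_t, f_t) - inf_{f} ∑ ℓ(z_t, f))`. -/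
noncomputable def minimaxRegret {Z E : Type*} (ℓ : Z → E → ℝ) (F : Set E) (T : ℕ) : EReal :=
  gameValue ℓ F T []

end OCO

namespace OCO

open Finset

variable {Z E : Type*}

/-! The player follows the leader, playing a minimizer of the cumulative loss so far. After `k`
rounds this loss is strongly convex with modulus `k * σ`, so it grows quadratically away from its
minimizer. When the leader moves by `d`, a round therefore costs at most `L * d - k * (σ / 4) * d ^
2`, hence at most `L ^ 2 / (k * σ)` (`cumLoss_leader_sub_le`). Telescoping over rounds
(`gameValue_le`) leaves a harmonic sum, which gives the logarithm. -/

/-- The cumulative loss of the fixed decision `g` against the moves recorded in `h`. -/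
def cumLoss {F : Set E} (ℓ : Z → E → ℝ) (h : List (Z × F)) (g : E) : ℝ :=
  (h.map fun r => ℓ r.1 g).sum

theorem cumLoss_append_singleton {F : Set E} (ℓ : Z → E → ℝ) (h : List (Z × F)) (z : Z) (f : F)
    (g : E) : cumLoss ℓ (h ++ [(z, f)]) g = cumLoss ℓ h g + ℓ z g := by
  simp [cumLoss]

theorem continuousOn_cumLoss [TopologicalSpace E] {F : Set E} {ℓ : Z → E → ℝ}
    (hℓ : ∀ z, ContinuousOn (ℓ z) F) (h : List (Z × F)) : ContinuousOn (cumLoss ℓ h) F := by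
  induction h with
  | nil => exact continuousOn_const
  | cons r h ih =>
    have : cumLoss ℓ (r :: h) = fun g => ℓ r.1 g + cumLoss ℓ h g := by
      ext g; simp [cumLoss]
    rw [this]
    exact (hℓ r.1).add ih

variable [AddCommGroup E] [Module ℝ E]

/-- The cumulative loss over `k` rounds is midpoint strongly convex with modulus `k * σ`. -/
theorem cumLoss_midpoint_le {F : Set E} {ℓ : Z → E → ℝ} {N : Seminorm ℝ E} {σ : ℝ}
    (h_strong : ∀ z : Z, ∀ f ∈ F, ∀ g ∈ F,
      ℓ z ((1 / 2 : ℝ) • (f + g)) ≤ (ℓ z f + ℓ z g) / 2 - σ / 8 * N (f - g) ^ 2)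
    (h : List (Z × F)) {f g : E} (hf : f ∈ F) (hg : g ∈ F) :
    cumLoss ℓ h ((1 / 2 : ℝ) • (f + g)) ≤
      (cumLoss ℓ h f + cumLoss ℓ h g) / 2 - h.length * (σ / 8 * N (f - g) ^ 2) := by
  induction h with
  | nil => simp [cumLoss]
  | cons r h ih =>
    have := h_strong r.1 f hf g hg
    simp only [cumLoss, List.map_cons, List.sum_cons, List.length_cons, Nat.cast_succ] at ih ⊢
    linarith

/-- Quadratic growth of the cumulative loss away from its minimizer. -/
theorem cumLoss_quadratic_growth {F : Set E} (hF : Convex ℝ F) {ℓ : Z → E → ℝ}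
    {N : Seminorm ℝ E} {σ : ℝ}
    (h_strong : ∀ z : Z, ∀ f ∈ F, ∀ g ∈ F,
      ℓ z ((1 / 2 : ℝ) • (f + g)) ≤ (ℓ z f + ℓ z g) / 2 - σ / 8 * N (f - g) ^ 2)
    (h : List (Z × F)) {f g : E} (hf : f ∈ F) (hg : g ∈ F) (hmin : IsMinOn (cumLoss ℓ h) F f) :
    h.length * (σ / 4 * N (f - g) ^ 2) ≤ cumLoss ℓ h g - cumLoss ℓ h f := by
  have hmem : (1 / 2 : ℝ) • (f + g) ∈ F := by
    rw [smul_add]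
    exact hF hf hg (by norm_num) (by norm_num) (by norm_num)
  have h₁ : cumLoss ℓ h f ≤ cumLoss ℓ h ((1 / 2 : ℝ) • (f + g)) := hmin hmem
  have h₂ := cumLoss_midpoint_le h_strong h hf hg
  linarith

/-- The price of following the leader for one round after `k` rounds, in units of `L ^ 2 / σ`. -/
noncomputable def roundCost (k : ℕ) : ℝ := if k = 0 then 4 else 1 / k

theorem mul_sub_mul_sq_le (L d : ℝ) {c : ℝ} (hc : 0 < c) :
    L * d - c * d ^ 2 ≤ L ^ 2 / (4 * c) := by
  rw [le_div_iff₀ (by positivity)]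
  nlinarith [sq_nonneg (L - 2 * c * d)]

/-- The excess, after a further round, of the old leader `f` over the new leader `g`. -/
theorem cumLoss_leader_sub_le {F : Set E} (hF : Convex ℝ F) {ℓ : Z → E → ℝ}
    {N : Seminorm ℝ E} {σ L : ℝ} (hσ : 0 < σ)
    (h_strong : ∀ z : Z, ∀ f ∈ F, ∀ g ∈ F,
      ℓ z ((1 / 2 : ℝ) • (f + g)) ≤ (ℓ z f + ℓ z g) / 2 - σ / 8 * N (f - g) ^ 2)
    (h_lip : ∀ z : Z, ∀ f ∈ F, ∀ g ∈ F, |ℓ z f - ℓ z g| ≤ L * N (f - g))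
    (h : List (Z × F)) (z : Z) (f g : F) (hf : IsMinOn (cumLoss ℓ h) F f)
    (hg : IsMinOn (cumLoss ℓ (h ++ [(z, f)])) F g) :
    cumLoss ℓ h f + ℓ z f - cumLoss ℓ (h ++ [(z, f)]) g ≤
      L ^ 2 / σ * roundCost h.length := by
  have h₁ := cumLoss_quadratic_growth hF h_strong h f.2 g.2 hf
  have h₂ := cumLoss_quadratic_growth hF h_strong _ g.2 f.2 hg
  have h₃ := (le_abs_self _).trans (h_lip z f f.2 g g.2)
  rw [map_sub_rev N] at h₂
  simp only [cumLoss_append_singleton, List.length_append, List.length_singleton] at h₂ ⊢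
  push_cast at h₂
  set d := N ((f : E) - g)
  unfold roundCost
  split_ifs with hk
  -- With no past losses, `h₁` gives no curvature. The excess `e` satisfies `e ≤ L * d` and, by
  -- growth around the new leader, `σ / 4 * d ^ 2 ≤ e`; so `e = 2 * e - e ≤ 2 * L * d - σ / 4 * d ^
  -- 2`.
  · rw [hk] at h₁ h₂
    have h₄ := mul_sub_mul_sq_le (2 * L) d (c := σ / 4) (by positivity)
    have h₅ : (2 * L) ^ 2 / (4 * (σ / 4)) = L ^ 2 / σ * 4 := by field_simp; ring
    norm_num at h₁ h₂
    linarith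
  · have hk' : (0 : ℝ) < h.length := by exact_mod_cast Nat.pos_of_ne_zero hk
    have h₄ := mul_sub_mul_sq_le L d (c := h.length * (σ / 4)) (by positivity)
    have h₅ : L ^ 2 / (4 * (h.length * (σ / 4))) = L ^ 2 / σ * (1 / h.length) := by
      field_simp
    linarith

/-- The constant 8 comes from the base case: the first two rounds cost `4 + 1 = 5`, and `8 * log 2 >
5.5`. The inductive step has ample room, since `log ((n + 1) / n) ≥ 1 / (n + 1)` and `1 / n ≤ 8 / (n
+ 1)`. -/
theorem sum_roundCost_le (n : ℕ) (hn : 2 ≤ n) :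
    ∑ k ∈ range n, roundCost k ≤ 8 * Real.log n := by
  induction n, hn using Nat.le_induction with
  | base =>
    have := Real.log_two_gt_d9
    norm_num [sum_range_succ, roundCost]
    linarith
  | succ n hn ih =>
    have hn' : (2 : ℝ) ≤ n := by exact_mod_cast hn
    have h₁ := Real.one_sub_inv_le_log_of_pos (x := ((n + 1 : ℝ) / n)) (by positivity)
    rw [Real.log_div (by positivity) (by positivity)] at h₁
    have h₂ : roundCost n ≤ 8 * (1 - ((n + 1 : ℝ) / n)⁻¹) := by
      rw [roundCost, if_neg (by omega), inv_div, one_sub_div (by positivity), ← mul_div_assoc,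
        div_le_div_iff₀ (by positivity) (by positivity)]
      nlinarith
    rw [sum_range_succ]
    push_cast
    linarith

/-- Following the leader bounds the value of the game after any history. -/
theorem gameValue_le [TopologicalSpace E] {F : Set E} (hF : Convex ℝ F) (hF_comp : IsCompact F)
    {ℓ : Z → E → ℝ} (hℓ : ∀ z, ContinuousOn (ℓ z) F)
    {N : Seminorm ℝ E} {σ L : ℝ} (hσ : 0 < σ)
    (h_strong : ∀ z : Z, ∀ f ∈ F, ∀ g ∈ F,
      ℓ z ((1 / 2 : ℝ) • (f + g)) ≤ (ℓ z f + ℓ z g) / 2 - σ / 8 * N (f - g) ^ 2)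
    (h_lip : ∀ z : Z, ∀ f ∈ F, ∀ g ∈ F, |ℓ z f - ℓ z g| ≤ L * N (f - g))
    (n : ℕ) (h : List (Z × F)) (f : F) (hf : IsMinOn (cumLoss ℓ h) F f) :
    gameValue ℓ F n h ≤ (((h.map fun r => ℓ r.1 r.2).sum - cumLoss ℓ h f +
      L ^ 2 / σ * ∑ k ∈ range n, roundCost (h.length + k) : ℝ) : EReal) := by
  induction n generalizing h f with
  | zero =>
    simp only [gameValue, regret, range_zero, sum_empty, mul_zero, add_zero, EReal.coe_sub]
    exact EReal.sub_le_sub le_rfl (le_iInf fun g => EReal.coe_le_coe_iff.2 (hf g.2))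
  | succ n ih =>
    -- The current leader `f` is the move played; after any reply `z`, compactness supplies the next
    -- leader.
    refine iInf_le_of_le f (iSup_le fun z => ?_)
    obtain ⟨g, hgF, hg⟩ :=
      hF_comp.exists_isMinOn ⟨f, f.2⟩ (continuousOn_cumLoss hℓ (h ++ [(z, f)]))
    refine (ih _ ⟨g, hgF⟩ hg).trans (EReal.coe_le_coe_iff.2 ?_)
    have := cumLoss_leader_sub_le hF hσ h_strong h_lip h z f ⟨g, hgF⟩ hf hg
    have hsum : ∑ k ∈ range n, roundCost ((h ++ [(z, f)]).length + k) =
        ∑ k ∈ range n, roundCost (h.length + (k + 1)) :=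
      sum_congr rfl fun k _ => by
        rw [List.length_append, List.length_singleton, add_assoc, add_comm 1 k]
    rw [hsum, sum_range_succ' _ n, mul_add, add_zero, List.map_append, List.sum_append]
    simp only [List.map_cons, List.map_nil, List.sum_singleton]
    linarith

end OCO

theorem mainTheorem4 {Z E : Type*}
    [TopologicalSpace Z] [CompactSpace Z] [Nonempty Z]
    [AddCommGroup E] [Module ℝ E] [TopologicalSpace E]
    [IsTopologicalAddGroup E] [ContinuousSMul ℝ E]
    (F : Set E) (hF_conv : Convex ℝ F) (hF_comp : IsCompact F) (hF_ne : F.Nonempty)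
    (ℓ : Z → E → ℝ)
    (hℓ_cont : ContinuousOn (fun q : Z × E => ℓ q.1 q.2) (Set.univ ×ˢ F))
    (hℓ_conv : ∀ z : Z, ConvexOn ℝ F (ℓ z))
    (N : Seminorm ℝ E) (hN : ∀ x : E, N x = 0 → x = 0)
    (σ L : ℝ) (hσ : 0 < σ)
    (h_strong : ∀ z : Z, ∀ f ∈ F, ∀ g ∈ F,
      ℓ z ((1 / 2 : ℝ) • (f + g)) ≤ (ℓ z f + ℓ z g) / 2 - σ / 8 * N (f - g) ^ 2)
    (h_lip : ∀ z : Z, ∀ f ∈ F, ∀ g ∈ F, |ℓ z f - ℓ z g| ≤ L * N (f - g))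
    (T : ℕ) (hT : 2 ≤ T) :
    OCO.minimaxRegret ℓ F T ≤ ((8 * L ^ 2 / σ * Real.log T : ℝ) : EReal) := by

  have hℓ : ∀ z, ContinuousOn (ℓ z) F := fun z =>
    hℓ_cont.comp (f := fun x : E => (z, x)) (by fun_prop) fun x hx => ⟨trivial, hx⟩
  obtain ⟨f, hf⟩ := hF_ne
  -- Before the first round the cumulative loss is zero, so every point of `F` is a leader.
  refine (OCO.gameValue_le hF_conv hF_comp hℓ hσ h_strong h_lip T [] ⟨f, hf⟩
    fun g _ => by simp [OCO.cumLoss]).trans (EReal.coe_le_coe_iff.2 ?_)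
  have h := mul_le_mul_of_nonneg_left (OCO.sum_roundCost_le T hT)
    (show 0 ≤ L ^ 2 / σ by positivity)
  simp only [OCO.cumLoss, List.map_nil, List.sum_nil, List.length_nil, zero_add, sub_zero]
  calc _ ≤ _ := h
    _ = _ := by ring
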